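/- Let $n\ge 2$ be an integer. For $m\in\mathbb{Q}$ and $j\ge 0$ let $g_m(j)$ be $1,\,-m,\,-m-1,\,-1,\,m,\,m+1$ according as $j\equiv 0,1,2,3,4,5\pmod 6$. For $t\in\mathbb{Z}$ put $m=t$ if $3\nmid n$ and $m=t/3$ if $3\mid n$, and let $$f^{(n)}_t(X)=\sum_{i=0}^{n}\binom{n}{i}\,g_m(n-i)\,X^i .$$ (This polynomial has integer coefficients.) Let $n_0$ be the greatest integer such that $$n_0^2\ \Big|\ \left(3^{n^2/2}\cdot n^n\right)^n ,$$ where divisibility is understood in the ring of algebraic integers (the right-hand side is irrational when $n$ is odd; for even $n$ this is ordinary divisibility of integers). Then an integral basis of the fields $\mathbb{Q}(\beta_t)$, where $\beta_t\in\mathbb{C}$ is a root of $f^{(n)}_t(X)$ and $t$ runs through the integers for which $t^2+t+1$ (if $3\nmid n$), respectively $t^2+3t+9$ (if $3\mid n$), is square-free, is repeating periodically modulo $n_0$. That is: for each residue class $r$ modulo $n_0$ there exist polynomials $h^{(r)}_0,\ldots,h^{(r)}_{n-1}\in\mathbb{Q}[X]$ with $\deg h^{(r)}_i=i$ such that, for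 every integer $t\equiv r\pmod{n_0}$ for which $f^{(n)}_t(X)$ is irreducible over $\mathbb{Q}$ and $t^2+t+1$ (if $3\nmid n$), respectively $t^2+3t+9$ (if $3\mid n$), is square-free, and for every root $\beta_t$ of $f^{(n)}_t(X)$, $$\left(h^{(r)}_0(\beta_t),\,h^{(r)}_1(\beta_t),\,\ldots,\,h^{(r)}_{n-1}(\beta_t)\right)$$ is an integral basis of $\mathbb{Q}(\beta_t)$. -/

import Mathlib

namespace SimplestFields

open Polynomial

/-- The coefficient function `g` (depending on the parameter `m`), of period `6` in `i`. -/
def gCoeff (m : ℚ) (i : ℕ) : ℚ :=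
  match i % 6 with
  | 0 => 1
  | 1 => -m
  | 2 => -m - 1
  | 3 => -1
  | 4 => m
  | _ => m + 1

/-- `f^{(n)}_m(X) = ∑_{i=0}^n binom(n,i) g(n-i) X^i`, for a rational parameter `m`. -/
noncomputable def fRat (n : ℕ) (m : ℚ) : ℚ[X] :=
  ∑ i ∈ Finset.range (n + 1), C ((n.choose i : ℚ) * gCoeff m (n - i)) * X ^ i

/-- `f^{(n)}_t(X)`, for an integer parameter `t`: it is `f^{(n)}_m(X)` with `m = t / 3` if `3 ∣ n`
and `m = t` otherwise. -/
noncomputable def f (n : ℕ) (t : ℤ) : ℚ[X] :=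
  fRat n (if 3 ∣ n then (t : ℚ) / 3 else (t : ℚ))

/-- The integer `t^2 + 3t + 9` (if `3 ∣ n`) or `t^2 + t + 1` (if `3 ∤ n`). -/
def quadValue (n : ℕ) (t : ℤ) : ℤ :=
  if 3 ∣ n then t ^ 2 + 3 * t + 9 else t ^ 2 + t + 1

/-- The family `w` of complex numbers is an integral basis of the number field `K`, that is, it is
(the image in `ℂ` of) a basis of the `ℤ`-module of algebraic integers of `K`. -/
def IsIntegralBasis (K : IntermediateField ℚ ℂ) {n : ℕ} (w : Fin n → ℂ) : Prop :=
  ∃ b : Module.Basis (Fin n) ℤ (NumberField.RingOfIntegers K),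
    ∀ i, ((b i : K) : ℂ) = w i

/-- For the family of polynomials `F t` of degree `n`, with `t` restricted to the set `S` of
integer parameters, an integral basis of the fields `ℚ(β_t)`, `β_t` a root of `F t`, is repeating
periodically modulo `n₀`: for every residue class `r` modulo `n₀` there are rational polynomials
`h 0, …, h (n - 1)`, with `h i` of degree `i`, such that for all parameters `t` in the class `r`
with `F t` irreducible, `(h 0 (β_t), …, h (n - 1) (β_t))` is an integral basis of `ℚ(β_t)`. -/
def RepeatsPeriodically (n : ℕ) (F : ℤ → ℚ[X]) (S : Set ℤ) (n₀ : ℕ) : Prop :=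
  ∀ r : ZMod n₀, ∃ h : Fin n → ℚ[X],
    (∀ i, (h i).degree = ((i : ℕ) : WithBot ℕ)) ∧
    ∀ t ∈ S, (t : ZMod n₀) = r → Irreducible (F t) →
      ∀ β : ℂ, aeval β (F t) = 0 →
        IsIntegralBasis (IntermediateField.adjoin ℚ {β}) (fun i => aeval β (h i))

/-- `x` divides `y` in the ring of algebraic integers. The real number `(3^{n²/2} n^n)^n` is a
rational integer only for even `n`, but it is an algebraic integer for every `n`; for rational
integers `x ≠ 0` and `y` this is the usual divisibility. -/
def AlgIntDvd (x y : ℝ) : Prop := ∃ z : ℝ, IsIntegral ℤ z ∧ y = x * z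

/-- `n₀` is the greatest integer whose square divides `(3^{n²/2} n^n)^n`. -/
def IsPeriodBound (n n₀ : ℕ) : Prop :=
  IsGreatest
    {a : ℕ | AlgIntDvd ((a : ℝ) ^ 2) (((3 : ℝ) ^ (((n : ℝ) ^ 2) / 2) * (n : ℝ) ^ n) ^ n)} n₀

end SimplestFields

namespace SimplestFields

open Polynomial

/-! Write `c = paramDenom n` and `m = t / c`. The sequence `g_m` satisfies the recurrence with
characteristic polynomial `x² - x + 1`, so `f n t = A (X + u)^n + B (X + v)^n`, where `u, v` are the
primitive sixth roots of unity and `3c²AB = quadValue n t` (`exists_pow_add_pow`).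

Bounded denominators: this shape gives the discriminant of `ℤ[β]` up to sign as `n^n (AB)^(n-1)
3^(n(n-1)/2)` (`discr_mul_eq`). For a prime `p ≠ 3` dividing the square-free `quadValue n t`, the
minimal polynomial of `cβ - t` is Eisenstein at `p`, so `p` does not divide the index `I` of `ℤ[β]`
in the integers of `ℚ(β)`. What remains is `I² ∣ n^n 3^⌊n²/2⌋` (`exists_index_sq_dvd`). If `d²` is
the largest square dividing that number, then `d` is a common denominator independent of `t`, and
`d^n ∣ n₀`.

Transfer: `Q(β)/d` is integral exactly when, for each `i`, the `X^i` coefficient of `∏ (X - Q(β_j))`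
is divisible by `d^(n-i)`. These coefficients are integer polynomials in the coefficients of `f`,
hence are determined modulo `d^n` by `t` modulo `d^n` (`isIntegral_aeval_div_of_map_eq`).

So for congruent `t`, the polynomials of degree below `n` with integral value at `β_t` form one and
the same lattice, and a triangular basis of it serves the whole residue class. -/

/-! ### Arithmetic of the period `n₀` -/

theorem dvd_of_sq_dvd_squarefree_mul_sq {s d I : ℕ} (hs : Squarefree s) (hd : d ≠ 0)
    (h : I ^ 2 ∣ s * d ^ 2) : I ∣ d := by
  have hg : 0 < Nat.gcd I d := Nat.gcd_pos_of_pos_right _ (Nat.pos_of_ne_zero hd)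
  obtain ⟨g, a, b, hg0, hab, rfl, rfl⟩ := Nat.exists_coprime' hg
  rw [mul_pow, mul_pow, ← mul_assoc] at h
  have h1 : a ^ 2 ∣ s * b ^ 2 := Nat.dvd_of_mul_dvd_mul_right (pow_pos hg0 2) h
  have h2 : a ^ 2 ∣ s := (Nat.Coprime.pow 2 2 hab).dvd_of_dvd_mul_right h1
  have h3 : IsUnit a := hs a (by rwa [← sq])
  rw [Nat.isUnit_iff] at h3
  simp [h3]

/-- Squaring removes the irrationality: a number is integral as soon as its square is, and a
rational algebraic integer is an integer. -/
theorem algIntDvd_sq_iff {n a : ℕ} (ha : a ≠ 0) :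
    AlgIntDvd ((a : ℝ) ^ 2) (((3 : ℝ) ^ (((n : ℝ) ^ 2) / 2) * (n : ℝ) ^ n) ^ n) ↔
      a ^ 4 ∣ (3 ^ n ^ 2 * n ^ (2 * n)) ^ n := by
  set Y : ℝ := ((3 : ℝ) ^ (((n : ℝ) ^ 2) / 2) * (n : ℝ) ^ n) ^ n with hY
  have ha' : (a : ℝ) ≠ 0 := by exact_mod_cast ha
  have hY2 : Y ^ 2 = (((3 ^ n ^ 2 * n ^ (2 * n)) ^ n : ℕ) : ℝ) := by
    have h3 : ((3 : ℝ) ^ (((n : ℝ) ^ 2) / 2)) ^ 2 = 3 ^ n ^ 2 := by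
      rw [← Real.rpow_natCast, ← Real.rpow_mul (by norm_num),
        show (n : ℝ) ^ 2 / 2 * ((2 : ℕ) : ℝ) = ((n ^ 2 : ℕ) : ℝ) by push_cast; ring,
        Real.rpow_natCast]
    rw [hY, ← pow_mul, mul_comm n 2, pow_mul, mul_pow, h3, ← pow_mul, mul_comm n 2]
    push_cast
    rfl
  constructor
  · rintro ⟨z, hz, hYz⟩
    have hz2 : z ^ 2 = algebraMap ℚ ℝ ((((3 ^ n ^ 2 * n ^ (2 * n)) ^ n : ℕ) : ℚ) / (a : ℚ) ^ 4) := by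
      rw [map_div₀, map_natCast, map_pow, map_natCast, ← hY2, hYz]
      field_simp
    have hint : IsIntegral ℤ ((((3 ^ n ^ 2 * n ^ (2 * n)) ^ n : ℕ) : ℚ) / (a : ℚ) ^ 4) := by
      have := hz.pow 2
      rw [hz2] at this
      exact (isIntegral_algebraMap_iff (algebraMap ℚ ℝ).injective).1 this
    obtain ⟨k, hk⟩ := IsIntegrallyClosed.isIntegral_iff.1 hint
    have ha4 : (a : ℚ) ^ 4 ≠ 0 := pow_ne_zero _ (by exact_mod_cast ha)
    rw [eq_div_iff ha4] at hk
    rw [← Int.natCast_dvd_natCast]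
    refine ⟨k, ?_⟩
    have hk' : (k : ℚ) * (a : ℚ) ^ 4 = (((3 ^ n ^ 2 * n ^ (2 * n)) ^ n : ℕ) : ℚ) := by
      simpa using hk
    have : k * (a : ℤ) ^ 4 = (((3 ^ n ^ 2 * n ^ (2 * n)) ^ n : ℕ) : ℤ) := by exact_mod_cast hk'
    rw [← this]
    push_cast
    ring
  · rintro ⟨k, hk⟩
    refine ⟨Y / a ^ 2, ?_, by field_simp⟩
    refine IsIntegral.of_pow (n := 2) (by norm_num) ?_
    have : (Y / (a : ℝ) ^ 2) ^ 2 = ((k : ℤ) : ℝ) := by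
      rw [div_pow, hY2, hk]
      push_cast
      field_simp
    rw [this]
    exact isIntegral_algebraMap (R := ℤ) (A := ℝ)

/-- The admissible `a` are closed under lcm, because `lcm(a, b)^4 = lcm(a^4, b^4)`; hence the
greatest one in size is also greatest for divisibility. -/
theorem IsPeriodBound.dvd {n n₀ a : ℕ} (h : IsPeriodBound n n₀) (hn : n ≠ 0)
    (ha : a ^ 4 ∣ (3 ^ n ^ 2 * n ^ (2 * n)) ^ n) : a ∣ n₀ := by
  have hW : (3 ^ n ^ 2 * n ^ (2 * n)) ^ n ≠ 0 := by positivity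
  have ne0 : ∀ b : ℕ, b ^ 4 ∣ (3 ^ n ^ 2 * n ^ (2 * n)) ^ n → b ≠ 0 := by
    rintro b hb rfl
    exact hW (Nat.eq_zero_of_zero_dvd (by rwa [zero_pow four_ne_zero] at hb))
  have hn0 : n₀ ≠ 0 := by
    have h1 : (1 : ℕ) ∈ {a : ℕ | AlgIntDvd ((a : ℝ) ^ 2)
        (((3 : ℝ) ^ (((n : ℝ) ^ 2) / 2) * (n : ℝ) ^ n) ^ n)} :=
      (algIntDvd_sq_iff one_ne_zero).2 (by simp)
    have := h.2 h1
    omega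
  have h0 := (algIntDvd_sq_iff hn0).1 h.1
  have hl : (Nat.lcm n₀ a) ^ 4 ∣ (3 ^ n ^ 2 * n ^ (2 * n)) ^ n := by
    rw [← Nat.pow_lcm_pow]
    exact Nat.lcm_dvd h0 ha
  have hle : Nat.lcm n₀ a ≤ n₀ := h.2 ((algIntDvd_sq_iff (ne0 _ hl)).2 hl)
  have := Nat.le_antisymm hle (Nat.le_of_dvd (Nat.pos_of_ne_zero (ne0 _ hl)) (Nat.dvd_lcm_left _ _))
  rw [← this]
  exact Nat.dvd_lcm_right _ _

/-- A common denominator `d` of the integral bases whose `n`-th power divides the period. -/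
theorem IsPeriodBound.exists_denominator {n n₀ : ℕ} (h : IsPeriodBound n n₀) (hn : n ≠ 0) :
    ∃ d : ℕ, d ≠ 0 ∧ d ^ n ∣ n₀ ∧ ∀ I : ℕ, I ^ 2 ∣ n ^ n * 3 ^ (n ^ 2 / 2) → I ∣ d := by
  -- `d²` is the largest square factor, so `d^4` divides the square of this number, which divides
  -- `3^(n²) n^(2n)`; the `n`-th power of this makes `d^n` admissible.
  obtain ⟨s, d, hsd, hs⟩ := Nat.sq_mul_squarefree (n ^ n * 3 ^ (n ^ 2 / 2))
  have hE : n ^ n * 3 ^ (n ^ 2 / 2) ≠ 0 := by positivity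
  have hd : d ≠ 0 := by
    rintro rfl
    exact hE (by rw [← hsd]; simp)
  refine ⟨d, hd, h.dvd hn ?_, fun I hI => dvd_of_sq_dvd_squarefree_mul_sq hs hd ?_⟩
  · rw [pow_right_comm]
    refine pow_dvd_pow_of_dvd ?_ n
    have h2 : d ^ 2 ∣ n ^ n * 3 ^ (n ^ 2 / 2) := ⟨s, hsd.symm⟩
    calc d ^ 4 = (d ^ 2) ^ 2 := by ring
      _ ∣ (n ^ n * 3 ^ (n ^ 2 / 2)) ^ 2 := pow_dvd_pow_of_dvd h2 2
      _ = 3 ^ (n ^ 2 / 2 * 2) * n ^ (2 * n) := by ring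
      _ ∣ _ := mul_dvd_mul_right (pow_dvd_pow _ (Nat.div_mul_le_self _ _)) _
  · rwa [mul_comm, hsd]

/-! ### Polynomials given by coefficient sequences -/

section SumForm

variable {R : Type*} [CommRing R]

theorem coeff_sum_C_mul_X_pow (a : ℕ → R) (n i : ℕ) :
    (∑ j ∈ Finset.range (n + 1), C (a j) * X ^ j).coeff i = if i ≤ n then a i else 0 := by
  rw [finsetSum_coeff]
  simp only [coeff_C_mul_X_pow, Finset.sum_ite_eq, Finset.mem_range, Nat.lt_succ_iff]

theorem monic_sum_C_mul_X_pow [Nontrivial R] {a : ℕ → R} {n : ℕ} (ha : a n = 1) :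
    (∑ j ∈ Finset.range (n + 1), C (a j) * X ^ j).Monic ∧
      (∑ j ∈ Finset.range (n + 1), C (a j) * X ^ j).natDegree = n := by
  have h1 : (∑ j ∈ Finset.range (n + 1), C (a j) * X ^ j).coeff n = 1 := by
    rw [coeff_sum_C_mul_X_pow, if_pos le_rfl, ha]
  have h2 : (∑ j ∈ Finset.range (n + 1), C (a j) * X ^ j).natDegree ≤ n := by
    refine natDegree_sum_le_of_forall_le _ _ fun i hi => ?_
    exact (natDegree_C_mul_X_pow_le _ _).trans (by simpa [Nat.lt_succ_iff] using hi)
  exact ⟨monic_of_natDegree_le_of_coeff_eq_one _ h2 h1,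
    le_antisymm h2 (le_natDegree_of_ne_zero (by rw [h1]; exact one_ne_zero))⟩

theorem sum_choose_mul_eq {s : ℕ → R} {A B u v : R} (hs : ∀ k, s k = A * u ^ k + B * v ^ k)
    (n : ℕ) : ∑ i ∈ Finset.range (n + 1), C ((n.choose i : R) * s (n - i)) * X ^ i =
      C A * (X + C u) ^ n + C B * (X + C v) ^ n := by
  rw [add_pow, add_pow, Finset.mul_sum, Finset.mul_sum, ← Finset.sum_add_distrib]
  refine Finset.sum_congr rfl fun i _ => ?_
  rw [hs]
  simp only [C_mul, C_add, C_pow, ← C_eq_natCast]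
  ring

end SumForm

/-! ### Transfer of integrality between congruent polynomials -/

/-- If `β` and `β'` are roots of the same irreducible polynomial, then the values of a rational
polynomial at `β` and at `β'` are simultaneously integral. -/
theorem isIntegral_aeval_of_irreducible {F P : ℚ[X]} (hF : Irreducible F) {β β' : ℂ}
    (hβ : aeval β F = 0) (hβ' : aeval β' F = 0) (h : IsIntegral ℤ (aeval β P)) :
    IsIntegral ℤ (aeval β' P) := by
  obtain ⟨W, hW, hW0⟩ := h
  refine ⟨W, hW, ?_⟩
  have key : ∀ x : ℂ, eval₂ (algebraMap ℤ ℂ) (aeval x P) W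
      = aeval x ((W.map (Int.castRingHom ℚ)).comp P) := by
    intro x
    rw [aeval_comp, aeval_def (x := aeval x P), eval₂_map]
    congr 1
  rw [key] at hW0 ⊢
  have hdvd : F ∣ (W.map (Int.castRingHom ℚ)).comp P := by
    have h1 := minpoly.dvd ℚ β hW0
    rw [← minpoly.eq_of_irreducible hF hβ] at h1
    exact (Dvd.intro _ rfl).trans h1
  obtain ⟨R, hR⟩ := hdvd
  rw [hR, map_mul, hβ', zero_mul]

/-- The polynomial `∏ (X - Q(β))`, where `β` runs through the roots of `F`. -/
noncomputable def rootImagePoly (F Q : ℤ[X]) (n k : ℕ) : ℤ[X] :=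
  resultant (F.map C) (C X - Q.map C) n k

/-- Resultants commute with ring homomorphisms. This is the reason for defining the polynomial by a
resultant and not as a product over roots. -/
theorem rootImagePoly_map_eq_of_map_eq {R : Type*} [CommRing R] (φ : ℤ →+* R) {F F' Q : ℤ[X]}
    (n k : ℕ) (h : F.map φ = F'.map φ) :
    (rootImagePoly F Q n k).map φ = (rootImagePoly F' Q n k).map φ := by
  have key : ∀ F : ℤ[X], (rootImagePoly F Q n k).map φ =
      resultant ((F.map φ).map C) (C X - (Q.map φ).map C) n k := by
    intro F
    have := resultant_map_map (F.map C) (C X - Q.map C) n k (mapRingHom φ)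
    rw [coe_mapRingHom] at this
    rw [rootImagePoly, ← this]
    congr 1
    · simp only [map_map, mapRingHom_comp_C]
    · simp only [Polynomial.map_sub, map_map, mapRingHom_comp_C, map_C, coe_mapRingHom, map_X]
  rw [key, key, h]

theorem rootImagePoly_map_complex {F : ℤ[X]} (hF : F.Monic) (Q : ℤ[X]) :
    (rootImagePoly F Q F.natDegree Q.natDegree).map (Int.castRingHom ℂ) =
      ((F.aroots ℂ).map fun β => X - C (aeval β Q)).prod := by
  refine Polynomial.funext fun x => ?_
  set φ : ℤ[X] →+* ℂ := eval₂RingHom (Int.castRingHom ℂ) x with hφ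
  have hφC : φ.comp C = Int.castRingHom ℂ := RingHom.ext_int _ _
  have hFm : (F.map (Int.castRingHom ℂ)).natDegree = F.natDegree := hF.natDegree_map _
  have h1 := resultant_map_map (F.map C) (C X - Q.map C) F.natDegree Q.natDegree φ
  rw [map_map, Polynomial.map_sub, map_map, map_C, hφC] at h1
  have hx : φ X = x := by simp [hφ]
  rw [hx] at h1
  have hdeg : (C x - Q.map (Int.castRingHom ℂ)).natDegree ≤ Q.natDegree :=
    (natDegree_sub_le _ _).trans (by simpa using natDegree_map_le)
  have h2 := resultant_eq_prod_eval (F.map (Int.castRingHom ℂ)) (C x - Q.map (Int.castRingHom ℂ))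
    Q.natDegree hdeg (IsAlgClosed.splits _)
  rw [hFm, (hF.map _).leadingCoeff, one_pow, one_mul] at h2
  rw [eval_map, rootImagePoly, ← coe_eval₂RingHom, ← hφ, ← h1, h2, eval_multiset_prod,
    Multiset.map_map]
  congr 1
  refine Multiset.map_congr rfl fun β _ => ?_
  simp only [Function.comp_apply, eval_sub, eval_C, eval_X, eval_map, aeval_def]
  rfl

theorem rootImagePoly_monic {F : ℤ[X]} (hF : F.Monic) (Q : ℤ[X]) :
    (rootImagePoly F Q F.natDegree Q.natDegree).Monic ∧
    (rootImagePoly F Q F.natDegree Q.natDegree).natDegree = F.natDegree := by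
  have hinj : Function.Injective (Int.castRingHom ℂ) := Int.cast_injective
  have h := rootImagePoly_map_complex hF Q
  constructor
  · refine monic_of_injective hinj ?_
    rw [h]
    exact monic_multiset_prod_of_monic _ _ fun β _ => monic_X_sub_C _
  · rw [← natDegree_map_eq_of_injective hinj, h, natDegree_multiset_prod_of_monic _ (by
      simp only [Multiset.mem_map]
      rintro _ ⟨β, _, rfl⟩
      exact monic_X_sub_C _), Multiset.map_map]
    simp only [Function.comp_def, natDegree_X_sub_C, Multiset.map_const', Multiset.sum_replicate,
      smul_eq_mul, mul_one]
    rw [aroots, ← (IsAlgClosed.splits _).natDegree_eq_card_roots]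
    exact hF.natDegree_map _

/-- All conjugates of `Q(β)/d` are integral, so the monic polynomial `T` with these roots has
integral coefficients. Scaling its roots by `d` multiplies the `i`-th coefficient by `d^(n-i)`,
where `n = F.natDegree`; the quotient is rational and integral, hence an integer. -/
theorem pow_dvd_coeff_rootImagePoly {F : ℤ[X]} (hF : F.Monic)
    (hirr : Irreducible (F.map (Int.castRingHom ℚ))) (Q : ℤ[X]) {d : ℕ} (hd : d ≠ 0) {β : ℂ}
    (hβ : aeval β F = 0) (hint : IsIntegral ℤ (aeval β Q / (d : ℂ))) (i : ℕ) :
    (d : ℤ) ^ (F.natDegree - i) ∣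
      (rootImagePoly F Q F.natDegree Q.natDegree).coeff i := by
  have hd' : (d : ℂ) ≠ 0 := by exact_mod_cast hd
  set T : ℂ[X] := ((F.aroots ℂ).map fun β => X - C (aeval β Q / (d : ℂ))).prod with hT
  have hS : (rootImagePoly F Q F.natDegree Q.natDegree).map (Int.castRingHom ℂ) =
      scaleRoots T (d : ℂ) := by
    rw [rootImagePoly_map_complex hF Q, hT]
    generalize F.aroots ℂ = s
    induction s using Multiset.induction_on with
    | empty => simp
    | cons b s ih =>
      rw [Multiset.map_cons, Multiset.prod_cons, Multiset.map_cons, Multiset.prod_cons, ih,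
        mul_scaleRoots_of_noZeroDivisors]
      congr 1
      rw [X_sub_C_scaleRoots, div_mul_cancel₀ _ hd']
  have hTdeg : T.natDegree = F.natDegree := by
    rw [← (rootImagePoly_monic hF Q).2, ← natDegree_scaleRoots T (d : ℂ), ← hS]
    exact natDegree_map_eq_of_injective (Int.cast_injective) _
  have hTint : IsIntegral ℤ (T.coeff i) := by
    have hint' : ∀ b ∈ F.aroots ℂ, IsIntegral ℤ (aeval b Q / (d : ℂ)) := by
      intro b hb
      have e : ∀ x : ℂ, aeval x Q / (d : ℂ) =
          aeval x (C ((d : ℚ)⁻¹) * Q.map (Int.castRingHom ℚ)) := by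
        intro x
        rw [map_mul, aeval_C, ← algebraMap_int_eq, aeval_map_algebraMap]
        simp [div_eq_inv_mul]
      rw [e] at hint ⊢
      rw [← aeval_map_algebraMap ℚ] at hβ
      refine isIntegral_aeval_of_irreducible hirr hβ ?_ hint
      rw [← algebraMap_int_eq, aeval_map_algebraMap]
      exact ((mem_aroots'.1 hb).2)
    have : T ∈ lifts (algebraMap (integralClosure ℤ ℂ) ℂ) := by
      rw [hT]
      refine multiset_prod_mem (S := lifts (algebraMap (integralClosure ℤ ℂ) ℂ)) _ ?_
      simp only [Multiset.mem_map]
      rintro _ ⟨b, hb, rfl⟩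
      rw [mem_lifts]
      exact ⟨X - C ⟨_, hint' b hb⟩, by simp⟩
    obtain ⟨y, hy⟩ := (lifts_iff_coeff_lifts _).1 this i
    rw [← hy]
    exact y.2
  have hc : ((rootImagePoly F Q F.natDegree Q.natDegree).coeff i : ℂ) =
      T.coeff i * (d : ℂ) ^ (F.natDegree - i) := by
    have := congrArg (coeff · i) hS
    simpa [coeff_scaleRoots, hTdeg] using this
  set a := (rootImagePoly F Q F.natDegree Q.natDegree).coeff i
  have hTa : T.coeff i = algebraMap ℚ ℂ ((a : ℚ) / (d : ℚ) ^ (F.natDegree - i)) := by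
    rw [map_div₀, map_pow, map_natCast, map_intCast, hc]
    field_simp
  rw [hTa, isIntegral_algebraMap_iff (algebraMap ℚ ℂ).injective,
    IsIntegrallyClosed.isIntegral_iff] at hTint
  obtain ⟨k, hk⟩ := hTint
  have hdq : (d : ℚ) ^ (F.natDegree - i) ≠ 0 := pow_ne_zero _ (by exact_mod_cast hd)
  rw [eq_div_iff hdq] at hk
  refine ⟨k, ?_⟩
  have hk' : (k : ℚ) * (d : ℚ) ^ (F.natDegree - i) = (a : ℚ) := by simpa using hk
  have hk2 : k * (d : ℤ) ^ (F.natDegree - i) = a := by exact_mod_cast hk'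
  rw [← hk2, mul_comm]

/-- Since `d^(n-i) ∣ d^n` for `n = F.natDegree`, the divisibility of the coefficients survives the
passage from `F` to `F'`. Dividing them out gives a monic integer polynomial `W` that kills
`Q(β')/d`. -/
theorem isIntegral_aeval_div_of_map_eq {F F' : ℤ[X]} (hF : F.Monic) (hF' : F'.Monic)
    (hdeg : F'.natDegree = F.natDegree)
    (hirr : Irreducible (F.map (Int.castRingHom ℚ))) (Q : ℤ[X]) {d : ℕ} (hd : d ≠ 0)
    (hmap : F.map (Int.castRingHom (ZMod (d ^ F.natDegree))) =
      F'.map (Int.castRingHom (ZMod (d ^ F.natDegree))))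
    {β β' : ℂ} (hβ : aeval β F = 0) (hβ' : aeval β' F' = 0)
    (hint : IsIntegral ℤ (aeval β Q / (d : ℂ))) :
    IsIntegral ℤ (aeval β' Q / (d : ℂ)) := by
  have hd' : (d : ℂ) ≠ 0 := by exact_mod_cast hd
  set R' := rootImagePoly F' Q F.natDegree Q.natDegree with hR'
  have hR'm : R'.Monic ∧ R'.natDegree = F.natDegree := by
    rw [hR', ← hdeg]
    exact rootImagePoly_monic hF' Q
  have hdvd : ∀ i, (d : ℤ) ^ (F.natDegree - i) ∣ R'.coeff i := by
    intro i
    have h1 := pow_dvd_coeff_rootImagePoly hF hirr Q hd hβ hint i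
    have h2 := congrArg (coeff · i) (rootImagePoly_map_eq_of_map_eq _ (Q := Q) F.natDegree
      Q.natDegree hmap)
    simp only [coeff_map, eq_intCast] at h2
    rw [ZMod.intCast_eq_intCast_iff_dvd_sub] at h2
    have h3 : (d : ℤ) ^ (F.natDegree - i) ∣ ((d ^ F.natDegree : ℕ) : ℤ) := by
      push_cast
      exact pow_dvd_pow _ (Nat.sub_le _ _)
    have := dvd_add (h3.trans h2) h1
    rwa [sub_add_cancel] at this
  choose w hw using hdvd
  set W : ℤ[X] := ∑ i ∈ Finset.range (F.natDegree + 1), C (w i) * X ^ i with hW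
  have hWtop : w F.natDegree = 1 := by
    have := hw F.natDegree
    rw [Nat.sub_self, pow_zero, one_mul] at this
    rw [← this, ← hR'm.2]
    exact hR'm.1
  obtain ⟨hWm, hWdeg⟩ := monic_sum_C_mul_X_pow hWtop
  rw [← hW] at hWm hWdeg
  have hRW : R' = scaleRoots W (d : ℤ) := by
    ext i
    rw [coeff_scaleRoots, hWdeg, hW, coeff_sum_C_mul_X_pow]
    split_ifs with hi
    · rw [hw i, mul_comm]
    · rw [coeff_eq_zero_of_natDegree_lt (by omega), zero_mul]
  refine ⟨W, hWm, ?_⟩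
  have h0 : eval₂ (Int.castRingHom ℂ) (aeval β' Q) R' = 0 := by
    rw [← eval_map, hR', ← hdeg, rootImagePoly_map_complex hF' Q, eval_multiset_prod,
      Multiset.map_map]
    refine Multiset.prod_eq_zero (Multiset.mem_map.2 ⟨β', ?_, by simp⟩)
    exact (mem_aroots').2 ⟨(hF'.map _).ne_zero, hβ'⟩
  have h1 := scaleRoots_eval₂_mul (p := W) (Int.castRingHom ℂ) (aeval β' Q / (d : ℂ)) (d : ℤ)
  rw [← hRW] at h1
  simp only [map_natCast] at h1
  rw [mul_div_cancel₀ _ hd', h0] at h1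
  have := h1.symm
  rw [mul_eq_zero] at this
  exact this.resolve_left (pow_ne_zero _ hd')

/-! ### Triangular generators and integral bases -/

/-- A lattice of rational polynomials of degree less than `n`, with bounded denominators and
containing all powers `X ^ i` with `i < n`, has a triangular system of generators. -/
theorem exists_triangular_generators (L : AddSubgroup ℚ[X]) {n d : ℕ} (hd : d ≠ 0)
    (hX : ∀ i < n, (X ^ i : ℚ[X]) ∈ L)
    (hL : ∀ P ∈ L, P.degree < n ∧ ∃ Q : ℤ[X], Q.map (Int.castRingHom ℚ) = C (d : ℚ) * P) :
    ∃ h : Fin n → ℚ[X], (∀ i, (h i).degree = ((i : ℕ) : WithBot ℕ)) ∧ (∀ i, h i ∈ L) ∧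
      ∀ P ∈ L, P ∈ Submodule.span ℤ (Set.range h) := by
  classical
  have hdq : (d : ℚ) ≠ 0 := by exact_mod_cast hd
  -- `h i` is to be an element of `L` of degree `i` with the least positive leading coefficient;
  -- multiplying by `d` makes these coefficients integers, so a least one exists.
  have hex : ∀ i : Fin n, ∃ k : ℕ, 0 < k ∧
      ∃ P ∈ L, P.degree < ((i : ℕ) + 1 : ℕ) ∧ (d : ℚ) * P.coeff i = k := fun i =>
    ⟨d, Nat.pos_of_ne_zero hd, X ^ (i : ℕ), hX i i.2, by
      rw [degree_X_pow]; exact_mod_cast Nat.lt_succ_self _, by simp⟩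
  choose h hhL hhdeg hhc using fun i => (Nat.find_spec (hex i)).2
  have hhc0 : ∀ i : Fin n, (h i).coeff i ≠ 0 := by
    intro i h0
    have h1 := hhc i
    rw [h0, mul_zero] at h1
    have := (Nat.find_spec (hex i)).1
    exact this.ne (by exact_mod_cast h1)
  refine ⟨h, fun i => ?_, hhL, fun P hP => ?_⟩
  · refine le_antisymm ?_ (le_degree_of_ne_zero (hhc0 i))
    rw [degree_le_iff_coeff_zero]
    intro m hm
    refine coeff_eq_zero_of_degree_lt ((hhdeg i).trans_le ?_)
    have : (i : ℕ) < m := by exact_mod_cast hm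
    exact_mod_cast this
  · have main : ∀ m ≤ n, ∀ P ∈ L, P.degree < (m : ℕ) →
        P ∈ Submodule.span ℤ (Set.range h) := by
      intro m
      induction m with
      | zero =>
        intro _ P _ hdeg
        have : P = 0 := by
          rw [← degree_eq_bot]
          exact Nat.WithBot.lt_zero_iff.1 (by exact_mod_cast hdeg)
        rw [this]
        exact Submodule.zero_mem _
      | succ m ih =>
        intro hmn P hP hdeg
        let i : Fin n := ⟨m, by omega⟩
        obtain ⟨Q, hQ⟩ := (hL P hP).2
        set k := Nat.find (hex i) with hk
        have hk0 : 0 < k := (Nat.find_spec (hex i)).1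
        set l := Q.coeff m with hl
        have hlP : (d : ℚ) * P.coeff m = l := by
          have := congrArg (coeff · m) hQ
          simpa using this.symm
        -- Division with remainder on leading coefficients: a nonzero remainder would contradict the
        -- minimality of `k`, so the degree drops.
        set P' := P - (l / (k : ℤ)) • h i with hP'
        have hP'L : P' ∈ L := L.sub_mem hP (L.zsmul_mem (hhL i) _)
        have hP'deg : P'.degree < ((m + 1 : ℕ) : WithBot ℕ) := by
          refine (degree_sub_le _ _).trans_lt (max_lt hdeg ?_)
          exact (degree_smul_le _ _).trans_lt (hhdeg i)
        have hP'c : (d : ℚ) * P'.coeff m = ((l % (k : ℤ) : ℤ) : ℚ) := by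
          have h1 : (d : ℚ) * (h i).coeff m = (k : ℚ) := hhc i
          have h2 : P'.coeff m = P.coeff m - ((l / (k : ℤ) : ℤ) : ℚ) * (h i).coeff m := by
            rw [hP', coeff_sub, coeff_smul, zsmul_eq_mul]
          have h3 : (((l % (k : ℤ) : ℤ)) : ℚ) = (l : ℚ) - (k : ℚ) * ((l / (k : ℤ) : ℤ) : ℚ) := by
            rw [Int.emod_def]; push_cast; ring
          rw [h2, h3, ← hlP, ← h1]
          ring
        have hk0' : (0 : ℤ) < k := by exact_mod_cast hk0
        have hr0 : l % (k : ℤ) = 0 := by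
          by_contra hr
          have hnn := Int.emod_nonneg l hk0'.ne'
          have hlt := Int.emod_lt_of_pos l hk0'
          obtain ⟨r, hr'⟩ := Int.eq_ofNat_of_zero_le hnn
          have := Nat.find_min' (hex i) (m := r)
            ⟨by omega, P', hP'L, hP'deg, by rw [hP'c, hr']; rfl⟩
          omega
        have hspan : P' ∈ Submodule.span ℤ (Set.range h) := by
          refine ih (by omega) P' hP'L ?_
          have hc : P'.coeff m = 0 := by
            rw [hr0, Int.cast_zero, mul_eq_zero] at hP'c
            exact hP'c.resolve_left hdq
          rw [degree_lt_iff_coeff_zero] at hP'deg ⊢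
          intro j hj
          rcases hj.eq_or_lt with rfl | hj
          · exact hc
          · exact hP'deg j hj
        have : P = P' + (l / (k : ℤ)) • h i := by rw [hP', sub_add_cancel]
        rw [this]
        exact Submodule.add_mem _ hspan
          (Submodule.smul_mem _ _ (Submodule.subset_span (Set.mem_range_self i)))
    exact main n le_rfl P hP (hL P hP).1

open NumberField in
-- The ring of integers is free of rank `n`, so `n` generators are automatically a basis.
theorem isIntegralBasis_of_span {K : IntermediateField ℚ ℂ} [NumberField K] {n : ℕ}
    (hK : Module.finrank ℚ K = n) {w : Fin n → ℂ} (hwK : ∀ i, w i ∈ K)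
    (hw : ∀ i, IsIntegral ℤ (w i))
    (hspan : ∀ z ∈ K, IsIntegral ℤ z → z ∈ Submodule.span ℤ (Set.range w)) :
    IsIntegralBasis K w := by
  have hint : ∀ z : K, IsIntegral ℤ (z : ℂ) ↔ IsIntegral ℤ z := fun z =>
    isIntegral_algebraMap_iff (A := K) (B := ℂ) (algebraMap K ℂ).injective
  let v : Fin n → 𝓞 K := fun i => ⟨⟨w i, hwK i⟩, (hint ⟨w i, hwK i⟩).1 (hw i)⟩
  let φ : 𝓞 K →ₗ[ℤ] ℂ :=
    ((algebraMap K ℂ).comp (algebraMap (𝓞 K) K)).toAddMonoidHom.toIntLinearMap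
  have hφ : Function.Injective φ :=
    (algebraMap K ℂ).injective.comp RingOfIntegers.coe_injective
  have hv : ⊤ ≤ Submodule.span ℤ (Set.range v) := by
    intro z _
    have h1 : φ z ∈ Submodule.span ℤ (Set.range w) :=
      hspan _ (z : K).2 ((hint _).2 z.isIntegral_coe)
    have h2 : Set.range w = φ '' Set.range v := by
      rw [← Set.range_comp]
      rfl
    rw [h2, ← Submodule.map_span] at h1
    obtain ⟨y, hy, hyz⟩ := h1
    rwa [← hφ hyz]
  have hcard : Fintype.card (Fin n) = Module.finrank ℤ (𝓞 K) := by
    rw [Fintype.card_fin, RingOfIntegers.rank, hK]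
  refine ⟨basisOfTopLeSpanOfCardEqFinrank v hv hcard, fun i => ?_⟩
  rw [coe_basisOfTopLeSpanOfCardEqFinrank]
  rfl

/-! ### The index of `ℤ[α]` and Eisenstein primes -/

open NumberField in
/-- The index of `ℤ[α]` in the ring of integers, with its relation to the discriminant. -/
theorem exists_index {K : Type*} [Field K] [NumberField K] (pb : PowerBasis ℚ K)
    (hint : IsIntegral ℤ pb.gen) :
    ∃ I : ℕ, (∀ z : K, IsIntegral ℤ z → I • z ∈ Algebra.adjoin ℤ {pb.gen}) ∧
      (∃ D : ℤ, Algebra.discr ℚ pb.basis = (I : ℚ) ^ 2 * D) ∧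
      ∀ p : ℕ, p.Prime → p ∣ I → ∃ z : K, IsIntegral ℤ z ∧ p • z ∈ Algebra.adjoin ℤ {pb.gen} ∧
        z ∉ Algebra.adjoin ℤ {pb.gen} := by
  set g : 𝓞 K := ⟨pb.gen, hint⟩ with hg
  have hgint : IsIntegral ℤ g := RingOfIntegers.isIntegral g
  set N : Submodule ℤ (𝓞 K) := Subalgebra.toSubmodule (Algebra.adjoin ℤ {g}) with hN
  have hNmem : ∀ z : 𝓞 K, z ∈ N ↔ (z : K) ∈ Algebra.adjoin ℤ {pb.gen} := by
    intro z
    have h1 := AlgHom.map_adjoin_singleton (IsScalarTower.toAlgHom ℤ (𝓞 K) K) g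
    have h2 : (IsScalarTower.toAlgHom ℤ (𝓞 K) K) g = pb.gen := rfl
    rw [h2] at h1
    rw [← h1, hN, Subalgebra.mem_toSubmodule, Subalgebra.mem_map]
    constructor
    · exact fun hz => ⟨z, hz, rfl⟩
    · rintro ⟨y, hy, hyz⟩
      have : y = z := RingOfIntegers.coe_injective hyz
      rwa [← this]
  set pb' : PowerBasis ℤ (Algebra.adjoin ℤ {g}) := Algebra.adjoin.powerBasis' hgint with hpb'
  have hdim : pb'.dim = pb.dim := by
    rw [hpb', Algebra.adjoin.powerBasis'_dim, ← pb.natDegree_minpoly,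
      minpoly.isIntegrallyClosed_eq_field_fractions' ℚ hint,
      (minpoly.monic hint).natDegree_map,
      ← minpoly.algebraMap_eq (B := 𝓞 K) (B' := K) RingOfIntegers.coe_injective g]
    rfl
  let bN : Module.Basis (Fin pb.dim) ℤ N := pb'.basis.reindex (finCongr hdim)
  have hbN : ∀ i, (((bN i : N) : 𝓞 K) : K) = pb.gen ^ (i : ℕ) := by
    intro i
    have h1 : bN i = pb'.gen ^ (i : ℕ) := by
      simp only [bN, Module.Basis.reindex_apply, PowerBasis.coe_basis]
      rfl
    rw [h1, hpb', Algebra.adjoin.powerBasis'_gen]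
    rfl
  have hrank : Module.finrank ℤ (𝓞 K) = pb.dim := by rw [RingOfIntegers.rank, pb.finrank]
  let b : Module.Basis (Fin pb.dim) ℤ (𝓞 K) := Module.finBasisOfFinrankEq _ _ hrank
  set P : Matrix (Fin pb.dim) (Fin pb.dim) ℤ := b.toMatrix ((↑) ∘ bN) with hP
  -- The index is the determinant of the change of basis from an integral basis to the powers of the
  -- generator; its square relates the two discriminants.
  have hcard : P.det.natAbs = Nat.card (𝓞 K ⧸ N) := by
    rw [← Submodule.natAbs_det_basis_change b N bN, Module.Basis.det_apply]
  have hdisc : Algebra.discr ℚ pb.basis =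
      (P.det : ℚ) ^ 2 * Algebra.discr ℚ (fun i => ((b i : 𝓞 K) : K)) := by
    have h1 : (pb.basis : Fin pb.dim → K) = Matrix.vecMul (fun i => ((b i : 𝓞 K) : K))
        ((P.map (Int.castRingHom ℚ)).map (algebraMap ℚ K)) := by
      ext j
      rw [PowerBasis.coe_basis]
      change pb.gen ^ (j : ℕ) = _
      rw [← hbN j]
      have h2 := b.sum_toMatrix_smul_self ((↑) ∘ bN) j
      rw [← hP] at h2
      have h3 := congrArg (algebraMap (𝓞 K) K) h2
      rw [Function.comp_apply] at h3
      refine h3.symm.trans ?_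
      rw [map_sum, Matrix.vecMul, dotProduct]
      refine Finset.sum_congr rfl fun i _ => ?_
      simp [mul_comm]
    rw [h1, Algebra.discr_of_matrix_vecMul]
    congr 2
    exact (RingHom.map_det (Int.castRingHom ℚ) P).symm
  obtain ⟨D, hD⟩ : ∃ D : ℤ, (D : ℚ) = Algebra.discr ℚ (fun i => ((b i : 𝓞 K) : K)) := by
    have h1 : IsIntegral ℤ (Algebra.discr ℚ (fun i => ((b i : 𝓞 K) : K))) :=
      Algebra.discr_isIntegral ℚ fun i => RingOfIntegers.isIntegral_coe _
    exact IsIntegrallyClosed.isIntegral_iff.1 h1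
  have hPdet : P.det ≠ 0 := by
    intro h0
    rw [h0] at hdisc
    exact Algebra.discr_not_zero_of_basis ℚ pb.basis (by rw [hdisc]; simp)
  have hcard0 : Nat.card (𝓞 K ⧸ N) ≠ 0 := by
    rw [← hcard]
    exact Int.natAbs_ne_zero.2 hPdet
  have hnsmul : ∀ (k : ℕ) (z : 𝓞 K), k • (Submodule.Quotient.mk z : 𝓞 K ⧸ N) = 0 →
      k • (z : K) ∈ Algebra.adjoin ℤ {pb.gen} := by
    intro k z h
    have h1 : N.mkQ (k • z) = 0 := by
      rw [map_nsmul]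
      exact h
    rw [Submodule.mkQ_apply, Submodule.Quotient.mk_eq_zero, hNmem] at h1
    rwa [← map_nsmul (algebraMap _ K) k z]
  refine ⟨Nat.card (𝓞 K ⧸ N), fun z hz => ?_, ⟨D, ?_⟩, fun p hp hpI => ?_⟩
  · exact hnsmul _ ⟨z, hz⟩ card_nsmul_eq_zero'
  · rw [hdisc, ← hD, ← hcard]
    congr 1
    rw [← sq_abs, ← Int.cast_abs, Int.abs_eq_natAbs]
    rfl
  · have := Fact.mk hp
    have : Finite (𝓞 K ⧸ N) := Nat.finite_of_card_ne_zero hcard0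
    -- Cauchy's theorem: a class of order `p` in the quotient is represented by the required `z`.
    obtain ⟨x, hx⟩ := exists_prime_addOrderOf_dvd_card' (G := 𝓞 K ⧸ N) p hpI
    obtain ⟨z, rfl⟩ := Submodule.Quotient.mk_surjective N x
    refine ⟨z, RingOfIntegers.isIntegral_coe _, ?_, ?_⟩
    · refine hnsmul p z ?_
      rw [← hx]
      exact addOrderOf_nsmul_eq_zero _
    · intro h1
      rw [← hNmem, ← Submodule.Quotient.mk_eq_zero] at h1
      rw [h1, addOrderOf_zero] at hx
      exact hp.one_lt.ne hx

theorem exists_pow_mul_mem_adjoin {A : Type*} [CommRing A] {x y : A} (c : ℤ)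
    (h : (c : A) * x ∈ Algebra.adjoin ℤ {y}) {z : A} (hz : z ∈ Algebra.adjoin ℤ {x}) :
    ∃ k : ℕ, (c : A) ^ k * z ∈ Algebra.adjoin ℤ {y} := by
  have hc : ∀ k : ℕ, (c : A) ^ k ∈ Algebra.adjoin ℤ {y} := fun k =>
    pow_mem (intCast_mem _ c) k
  induction hz using Algebra.adjoin_induction with
  | mem a ha =>
    obtain rfl := Set.mem_singleton_iff.1 ha
    exact ⟨1, by rwa [pow_one]⟩
  | algebraMap r => exact ⟨0, by rw [pow_zero, one_mul]; exact Subalgebra.algebraMap_mem _ r⟩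
  | add a b _ _ iha ihb =>
    obtain ⟨k, hk⟩ := iha
    obtain ⟨l, hl⟩ := ihb
    refine ⟨k + l, ?_⟩
    have : (c : A) ^ (k + l) * (a + b) = (c : A) ^ l * ((c : A) ^ k * a) +
      (c : A) ^ k * ((c : A) ^ l * b) := by ring
    rw [this]
    exact add_mem (mul_mem (hc _) hk) (mul_mem (hc _) hl)
  | mul a b _ _ iha ihb =>
    obtain ⟨k, hk⟩ := iha
    obtain ⟨l, hl⟩ := ihb
    refine ⟨k + l, ?_⟩
    have : (c : A) ^ (k + l) * (a * b) = ((c : A) ^ k * a) * ((c : A) ^ l * b) := by ring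
    rw [this]
    exact mul_mem hk hl

theorem exists_powerBasis_gen_eq {K : Type*} [Field K] [NumberField K] (pb : PowerBasis ℚ K)
    {c : ℤ} (hc : c ≠ 0) (t : ℤ) : ∃ B : PowerBasis ℚ K, B.gen = (c : K) * pb.gen - t := by
  have hc' : (c : K) ≠ 0 := by exact_mod_cast hc
  set y : K := (c : K) * pb.gen - t with hy
  have htop : Algebra.adjoin ℚ {y} = ⊤ := by
    rw [eq_top_iff, ← pb.adjoin_gen_eq_top, Algebra.adjoin_le_iff, Set.singleton_subset_iff]
    have h1 : pb.gen = algebraMap ℚ K (c : ℚ)⁻¹ * (y + algebraMap ℚ K t) := by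
      rw [hy, map_inv₀, map_intCast, map_intCast]
      field_simp
      ring
    rw [h1]
    exact mul_mem (Subalgebra.algebraMap_mem _ _)
      (add_mem (Algebra.subset_adjoin rfl) (Subalgebra.algebraMap_mem _ _))
  exact ⟨PowerBasis.ofAdjoinEqTop (Algebra.IsIntegral.isIntegral y) htop,
    PowerBasis.ofAdjoinEqTop_gen _ _⟩

/-- With `y = cα - t`, the rings `ℤ[y] ⊆ ℤ[α]` differ only by powers of `c`, which is prime to `p`.
A power `c^k` moves `p z` into `ℤ[y]`, the Eisenstein criterion gives `c^k z ∈ ℤ[y]`, and a Bézout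
relation between `p` and `c^k` recovers `z`. -/
theorem mem_adjoin_of_prime_nsmul_mem {K : Type*} [Field K] [NumberField K] (pb : PowerBasis ℚ K)
    (hint : IsIntegral ℤ pb.gen) {c t : ℤ} {p : ℕ} (hp : p.Prime) (hpc : ¬ (p : ℤ) ∣ c)
    (hei : (minpoly ℤ ((c : K) * pb.gen - t)).IsEisensteinAt (Submodule.span ℤ {(p : ℤ)}))
    {z : K} (hz : IsIntegral ℤ z) (hpz : p • z ∈ Algebra.adjoin ℤ {pb.gen}) :
    z ∈ Algebra.adjoin ℤ {pb.gen} := by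
  set y : K := (c : K) * pb.gen - t with hy
  have hc0 : c ≠ 0 := by
    rintro rfl
    exact hpc (dvd_zero _)
  have hcint : IsIntegral ℤ (c : K) := isIntegral_algebraMap (R := ℤ) (A := K) (x := c)
  have htint : IsIntegral ℤ (t : K) := isIntegral_algebraMap (R := ℤ) (A := K) (x := t)
  have hyint : IsIntegral ℤ y := (hcint.mul hint).sub htint
  obtain ⟨B, hB⟩ := exists_powerBasis_gen_eq pb hc0 t
  have hcy : (c : K) * pb.gen ∈ Algebra.adjoin ℤ {y} := by
    have : (c : K) * pb.gen = y + (t : K) := by rw [hy]; ring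
    rw [this]
    exact add_mem (Algebra.subset_adjoin rfl) (intCast_mem _ t)
  have hyle : Algebra.adjoin ℤ {y} ≤ Algebra.adjoin ℤ {pb.gen} := by
    rw [Algebra.adjoin_le_iff, Set.singleton_subset_iff]
    exact sub_mem (mul_mem (intCast_mem _ c) (Algebra.subset_adjoin rfl)) (intCast_mem _ t)
  obtain ⟨k, hk⟩ := exists_pow_mul_mem_adjoin c hcy hpz
  have hmem : (c : K) ^ k * z ∈ Algebra.adjoin ℤ {y} := by
    have h1 := mem_adjoin_of_smul_prime_smul_of_minpoly_isEisensteinAt (K := ℚ) (R := ℤ) (B := B)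
      (p := (p : ℤ)) (z := (c : K) ^ k * z) (Nat.prime_iff_prime_int.1 hp) (by rwa [hB])
      ((hcint.pow k).mul hz)
    rw [hB] at h1
    refine h1 ?_ hei
    have : (p : ℤ) • ((c : K) ^ k * z) = (c : K) ^ k * (p • z) := by
      rw [zsmul_eq_mul, nsmul_eq_mul]
      push_cast
      ring
    rwa [this]
  have hcop : IsCoprime (p : ℤ) (c ^ k) :=
    ((Nat.prime_iff_prime_int.1 hp).coprime_iff_not_dvd.2 hpc).pow_right
  obtain ⟨u, v, huv⟩ := hcop
  have huv' : (u : K) * p + v * (c : K) ^ k = 1 := by exact_mod_cast congrArg (Int.cast (R := K)) huv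
  have : z = (u : K) * (p • z) + (v : K) * ((c : K) ^ k * z) := by
    rw [nsmul_eq_mul]
    linear_combination (-z) * huv'
  rw [this]
  exact add_mem (mul_mem (intCast_mem _ u) hpz) (mul_mem (intCast_mem _ v) (hyle hmem))

/-! ### The discriminant of a sum of two `n`-th powers -/

/-- The norm of `F'(α)`, where `F = A (X + u) ^ n + B (X + v) ^ n` is the minimal polynomial
of `α`. -/
theorem norm_aeval_derivative {K : Type*} [Field K] [NumberField K] (pb : PowerBasis ℚ K)
    {A B u v : ℂ} {n : ℕ} (hn : n ≠ 0) (hB : B ≠ 0) (huv : u ≠ v) (hdim : pb.dim = n)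
    (hF : (minpoly ℚ pb.gen).map (algebraMap ℚ ℂ) = C A * (X + C u) ^ n + C B * (X + C v) ^ n) :
    ∃ e : ℕ, algebraMap ℚ ℂ (Algebra.norm ℚ (aeval pb.gen (minpoly ℚ pb.gen).derivative)) =
      (-1) ^ e * (n ^ n * (A * B) ^ (n - 1) * (u - v) ^ (n * (n - 1))) := by
  obtain ⟨m, rfl⟩ := Nat.exists_eq_succ_of_ne_zero hn
  set F := (minpoly ℚ pb.gen).map (algebraMap ℚ ℂ) with hFdef
  have hmon : F.Monic := (minpoly.monic pb.isIntegral_gen).map _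
  have hsplit : F.Splits := IsAlgClosed.splits _
  have hcard : F.roots.card = m + 1 := by
    rw [← hsplit.natDegree_eq_card_roots, hFdef, natDegree_map, pb.natDegree_minpoly, hdim]
  have hsep : F.Separable := (minpoly.irreducible pb.isIntegral_gen).separable.map
  have hnorm : algebraMap ℚ ℂ (Algebra.norm ℚ (aeval pb.gen (minpoly ℚ pb.gen).derivative)) =
      (F.roots.map fun r => F.derivative.eval r).prod := by
    classical
    rw [Algebra.norm_eq_prod_embeddings]
    have h1 : ∀ σ : K →ₐ[ℚ] ℂ, σ (aeval pb.gen (minpoly ℚ pb.gen).derivative) =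
        F.derivative.eval ((pb.liftEquiv' σ : { y : ℂ // y ∈ (minpoly ℚ pb.gen).aroots ℂ }) : ℂ) := by
      intro σ
      rw [← aeval_algHom_apply, hFdef, derivative_map, eval_map_algebraMap]
      rfl
    rw [Finset.prod_congr rfl fun σ _ => h1 σ, Equiv.prod_comp pb.liftEquiv'
      (fun y : { y : ℂ // y ∈ (minpoly ℚ pb.gen).aroots ℂ } => F.derivative.eval (y : ℂ))]
    have h2 := Finset.prod_mk (M := ℂ) F.roots (nodup_roots hsep) fun r => F.derivative.eval r
    rw [← h2]
    exact (Finset.prod_subtype (⟨F.roots, nodup_roots hsep⟩ : Finset ℂ) (fun x => Iff.rfl)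
      fun r => F.derivative.eval r).symm
  -- Substitute `A (r + u)^n = -B (r + v)^n` in `(r + u) F'(r)`. The product over all roots is then
  -- computable, since `∏ (r + w) = (-1)^n F(-w)` and one of the two powers vanishes at `-u` and at
  -- `-v`.
  have hroot : ∀ r ∈ F.roots, F.derivative.eval r * (r + u) =
      ((m + 1 : ℕ) : ℂ) * B * (u - v) * (r + v) ^ m := by
    intro r hr
    have h0 : F.eval r = 0 := (mem_roots'.1 hr).2
    rw [hF] at h0 ⊢
    simp only [eval_add, eval_mul, eval_C, eval_pow, eval_X, derivative_add, derivative_mul,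
      derivative_C, zero_mul, zero_add, derivative_pow, derivative_X, derivative_C, add_zero,
      mul_one, Nat.succ_eq_add_one, Nat.add_sub_cancel] at h0 ⊢
    linear_combination ((m + 1 : ℕ) : ℂ) * h0
  have hprod : ∀ w : ℂ, (F.roots.map fun r => r + w).prod = (-1) ^ (m + 1) * F.eval (-w) := by
    intro w
    rw [hsplit.eval_eq_prod_roots_of_monic hmon, ← hcard, ← Multiset.card_map (fun r => -w - r),
      ← Multiset.prod_map_neg, Multiset.map_map]
    congr 1
    refine Multiset.map_congr rfl fun r _ => ?_
    simp
  have hmain := congrArg Multiset.prod (Multiset.map_congr (rfl : F.roots = F.roots) hroot)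
  rw [Multiset.prod_map_mul, Multiset.prod_map_mul, ← hnorm, Multiset.prod_map_pow, hprod, hprod,
    Multiset.map_const', Multiset.prod_replicate, hcard, hF] at hmain
  simp only [eval_add, eval_mul, eval_C, eval_pow, eval_X, neg_add_cancel, Nat.succ_eq_add_one,
    zero_pow (Nat.succ_ne_zero m), mul_zero, add_zero, zero_add] at hmain
  have huv' : u - v ≠ 0 := sub_ne_zero.2 huv
  refine ⟨(m + 1) * m, ?_⟩
  have hsign : (-1 : ℂ) ^ (m + 1) * (B * (-u + v) ^ (m + 1)) = B * (u - v) ^ (m + 1) := by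
    have : (-u + v) = -1 * (u - v) := by ring
    rw [this, mul_pow, mul_left_comm B, ← mul_assoc, ← mul_pow]
    simp
  rw [hsign] at hmain
  refine mul_right_cancel₀ (mul_ne_zero hB (pow_ne_zero (m + 1) huv')) (hmain.trans ?_)
  have : (-v + u) = u - v := by ring
  rw [this, Nat.succ_eq_add_one, Nat.add_sub_cancel]
  generalize u - v = δ
  ring

/-! ### The polynomials `f n t` and the shifted polynomials -/

/-- With `δ² = -3`, `u` and `v` are the roots `(1 ± δ)/2` of `x² - x + 1`; `A` and `B` solve the
linear system fixing the initial values `1` and `-m` of `g_m`. -/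
theorem exists_root_data (m : ℂ) : ∃ A B u v : ℂ, u + v = 1 ∧ u * v = 1 ∧ (u - v) ^ 2 = -3 ∧
    A + B = 1 ∧ A * u + B * v = -m ∧ 3 * (A * B) = m ^ 2 + m + 1 := by
  obtain ⟨δ, hδ⟩ := IsAlgClosed.exists_pow_nat_eq (-3 : ℂ) (n := 2) (by norm_num)
  have hδ0 : δ ≠ 0 := by
    rintro rfl
    norm_num at hδ
  refine ⟨(-m - (1 - δ) / 2) / δ, (m + (1 + δ) / 2) / δ, (1 + δ) / 2, (1 - δ) / 2, ?_, ?_, ?_, ?_,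
    ?_, ?_⟩
  · ring
  · linear_combination (-1 / 4) * hδ
  · linear_combination hδ
  · field_simp
    ring
  · field_simp
    ring
  · field_simp
    linear_combination (-(2 * m + 1) ^ 2) * hδ

theorem gCoeff_add_two (m : ℚ) (k : ℕ) : gCoeff m (k + 2) = gCoeff m (k + 1) - gCoeff m k := by
  have h : k % 6 < 6 := Nat.mod_lt _ (by norm_num)
  unfold gCoeff
  rw [Nat.add_mod k 2, Nat.add_mod k 1]
  interval_cases k % 6 <;> norm_num <;> ring

theorem eq_of_linear_recurrence {s : ℕ → ℂ} {A B u v : ℂ} (h0 : s 0 = A + B)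
    (h1 : s 1 = A * u + B * v) (h : ∀ k, s (k + 2) = (u + v) * s (k + 1) - u * v * s k) (k : ℕ) :
    s k = A * u ^ k + B * v ^ k := by
  induction k using Nat.twoStepInduction with
  | zero => simp [h0]
  | one => simp [h1]
  | more k ih1 ih2 =>
    rw [h, ih1, ih2]
    ring

/-- The denominator of the parameter `m`. -/
def paramDenom (n : ℕ) : ℤ := if 3 ∣ n then 3 else 1

theorem paramDenom_eq (n : ℕ) : paramDenom n = 3 ∨ paramDenom n = 1 := by
  unfold paramDenom
  split_ifs <;> simp

theorem paramDenom_ne_zero (n : ℕ) : paramDenom n ≠ 0 := by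
  rcases paramDenom_eq n with h | h <;> rw [h] <;> norm_num

theorem f_eq (n : ℕ) (t : ℤ) : f n t = fRat n ((t : ℚ) / paramDenom n) := by
  unfold f paramDenom
  split_ifs <;> simp

theorem quadValue_eq (n : ℕ) (t : ℤ) :
    quadValue n t = t ^ 2 + paramDenom n * t + paramDenom n ^ 2 := by
  unfold quadValue paramDenom
  split_ifs <;> ring

/-- The constant term of `g_m(k)` as a polynomial in `m`. -/
def gConst (k : ℕ) : ℤ :=
  match k % 6 with
  | 0 => 1
  | 1 => 0
  | 2 => -1
  | 3 => -1
  | 4 => 0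
  | _ => 1

/-- The linear coefficient of `g_m(k)` as a polynomial in `m`. -/
def gLin (k : ℕ) : ℤ :=
  match k % 6 with
  | 0 => 0
  | 1 => -1
  | 2 => -1
  | 3 => 0
  | 4 => 1
  | _ => 1

theorem gCoeff_eq (m : ℚ) (k : ℕ) : gCoeff m k = gConst k + gLin k * m := by
  have h : k % 6 < 6 := Nat.mod_lt _ (by norm_num)
  unfold gCoeff gConst gLin
  interval_cases k % 6 <;> push_cast <;> ring

theorem gLin_eq_zero {k : ℕ} (h : 3 ∣ k) : gLin k = 0 := by
  have h : k % 6 = 0 ∨ k % 6 = 3 := by omega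
  unfold gLin
  rcases h with h | h <;> simp [h]

/-- This makes `f n t` integral when `m = t/3`: if `3 ∣ i` the linear coefficient vanishes, and
otherwise `i·binom(n,i) = n·binom(n-1,i-1)` forces `3 ∣ binom(n,i)`. -/
theorem paramDenom_dvd {n i : ℕ} (hi : i ≤ n) :
    paramDenom n ∣ (n.choose i : ℤ) * gLin (n - i) := by
  unfold paramDenom
  split_ifs with h
  · by_cases h3 : 3 ∣ i
    · rw [gLin_eq_zero (Nat.dvd_sub h h3), mul_zero]
      exact dvd_zero _
    · refine Dvd.dvd.mul_right ?_ _
      have hi0 : i ≠ 0 := by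
        rintro rfl
        exact h3 (dvd_zero _)
      have hn0 : n ≠ 0 := by omega
      obtain ⟨j, rfl⟩ := Nat.exists_eq_succ_of_ne_zero hi0
      obtain ⟨l, rfl⟩ := Nat.exists_eq_succ_of_ne_zero hn0
      have h1 := Nat.add_one_mul_choose_eq l j
      have h2 : 3 ∣ (l + 1).choose (j + 1) * (j + 1) := by
        rw [← h1]
        exact Dvd.dvd.mul_right h _
      exact_mod_cast ((Nat.Prime.dvd_mul Nat.prime_three).1 h2).resolve_right h3
  · exact one_dvd _

/-- The polynomial `f n t` with integer coefficients. -/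
noncomputable def fInt (n : ℕ) (t : ℤ) : ℤ[X] :=
  ∑ i ∈ Finset.range (n + 1),
    C ((n.choose i : ℤ) * gConst (n - i) + (n.choose i : ℤ) * gLin (n - i) / paramDenom n * t) *
      X ^ i

theorem fInt_map (n : ℕ) (t : ℤ) : (fInt n t).map (Int.castRingHom ℚ) = f n t := by
  rw [f_eq, fInt, fRat, Polynomial.map_sum]
  refine Finset.sum_congr rfl fun i hi => ?_
  rw [Polynomial.map_mul, Polynomial.map_pow, map_X, map_C]
  congr 2
  obtain ⟨q, hq⟩ := paramDenom_dvd (Nat.lt_succ_iff.1 (Finset.mem_range.1 hi))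
  have hc : (paramDenom n : ℚ) ≠ 0 := by exact_mod_cast paramDenom_ne_zero n
  have hq' : (n.choose i : ℚ) * gLin (n - i) = paramDenom n * q := by exact_mod_cast hq
  rw [hq, Int.mul_ediv_cancel_left _ (paramDenom_ne_zero n), gCoeff_eq, eq_intCast]
  push_cast
  rw [mul_add, ← mul_assoc (n.choose i : ℚ) (gLin (n - i) : ℚ), hq']
  field_simp

theorem fInt_monic (n : ℕ) (t : ℤ) : (fInt n t).Monic ∧ (fInt n t).natDegree = n := by
  refine monic_sum_C_mul_X_pow ?_
  simp [gConst, gLin]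

theorem fInt_map_zmod_eq {n M : ℕ} {t t' : ℤ} (h : (t : ZMod M) = t') :
    (fInt n t).map (Int.castRingHom (ZMod M)) = (fInt n t').map (Int.castRingHom (ZMod M)) := by
  simp only [fInt, Polynomial.map_sum, Polynomial.map_mul, Polynomial.map_pow, map_X, map_C]
  simp only [map_add, map_mul, eq_intCast, h]

/-- The sequence giving, up to binomial coefficients, the coefficients of the minimal polynomial
of `c β - t`. -/
def shiftSeq (T N : ℤ) : ℕ → ℤ
  | 0 => 1
  | 1 => 0
  | k + 2 => T * shiftSeq T N (k + 1) - N * shiftSeq T N k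

theorem dvd_shiftSeq (T N : ℤ) (k : ℕ) : N ∣ shiftSeq T N (k + 1) := by
  induction k with
  | zero => exact dvd_zero _
  | succ k ih => exact dvd_sub (Dvd.dvd.mul_left ih _) (Dvd.intro _ rfl)

/-- Modulo `N²` the recurrence reduces to multiplication by `T`, because its other term is `N` times
a multiple of `N`. It controls the constant term in the Eisenstein criterion. -/
theorem sq_dvd_shiftSeq_add (T N : ℤ) (k : ℕ) : N ^ 2 ∣ shiftSeq T N (k + 2) + N * T ^ k := by
  induction k with
  | zero => simp [shiftSeq]
  | succ k ih =>
    have h : shiftSeq T N (k + 1 + 2) + N * T ^ (k + 1) =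
        T * (shiftSeq T N (k + 2) + N * T ^ k) - N * shiftSeq T N (k + 1) := by
      rw [shiftSeq]
      ring
    rw [h, sq]
    exact dvd_sub (Dvd.dvd.mul_left (by rwa [← sq]) _) (mul_dvd_mul_left _ (dvd_shiftSeq T N k))

/-- The minimal polynomial of `c β - t`, where `c` is the denominator of the parameter. -/
noncomputable def shiftPoly (n : ℕ) (t : ℤ) : ℤ[X] :=
  ∑ i ∈ Finset.range (n + 1),
    C ((n.choose i : ℤ) * shiftSeq (2 * t + paramDenom n) (quadValue n t) (n - i)) * X ^ i

theorem shiftPoly_monic (n : ℕ) (t : ℤ) : (shiftPoly n t).Monic ∧ (shiftPoly n t).natDegree = n := by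
  refine monic_sum_C_mul_X_pow ?_
  simp [shiftSeq]

theorem shiftPoly_isEisensteinAt {n : ℕ} (hn : 2 ≤ n) {t : ℤ} (hsq : Squarefree (quadValue n t))
    {p : ℕ} (hp : p.Prime) (hp3 : p ≠ 3) (hpN : (p : ℤ) ∣ quadValue n t) :
    (shiftPoly n t).IsEisensteinAt (Submodule.span ℤ {(p : ℤ)}) := by
  have hpZ : Prime (p : ℤ) := Nat.prime_iff_prime_int.1 hp
  have hp3' : ¬ (p : ℤ) ∣ 3 := by
    intro h
    exact hp3 ((Nat.prime_dvd_prime_iff_eq hp Nat.prime_three).1 (by exact_mod_cast h))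
  have hcoeff : ∀ i ≤ n, (shiftPoly n t).coeff i =
      (n.choose i : ℤ) * shiftSeq (2 * t + paramDenom n) (quadValue n t) (n - i) := by
    intro i hi
    rw [shiftPoly, coeff_sum_C_mul_X_pow, if_pos hi]
  refine ⟨?_, fun {i} hi => ?_, ?_⟩
  · rw [(shiftPoly_monic n t).1.leadingCoeff]
    exact fun h => hpZ.not_dvd_one (Ideal.mem_span_singleton.1 h)
  · rw [(shiftPoly_monic n t).2] at hi
    rw [hcoeff i hi.le]
    obtain ⟨k, hk⟩ : ∃ k, n - i = k + 1 := ⟨n - i - 1, by omega⟩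
    rw [hk]
    exact Ideal.mem_span_singleton.2 (Dvd.dvd.mul_left (hpN.trans (dvd_shiftSeq _ _ _)) _)
  · rw [hcoeff 0 (Nat.zero_le _)]
    obtain ⟨k, rfl⟩ : ∃ k, n = k + 2 := ⟨n - 2, by omega⟩
    intro h
    have h1 : (p : ℤ) ^ 2 ∣
        shiftSeq (2 * t + paramDenom (k + 2)) (quadValue (k + 2) t) (k + 2) := by
      have := (Ideal.span_singleton_pow (p : ℤ) 2).symm ▸ h
      have := Ideal.mem_span_singleton.1 this
      simpa using this
    have h2 := (pow_dvd_pow_of_dvd hpN 2).trans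
      (sq_dvd_shiftSeq_add (2 * t + paramDenom (k + 2)) (quadValue (k + 2) t) k)
    have h3 := (dvd_add_right h1).1 h2
    -- `4 quadValue - (2t + c)² = 3c²`, and `c` is `1` or `3`, so a common prime divisor would have
    -- to be `3`.
    have h4 : ¬ (p : ℤ) ∣ (2 * t + paramDenom (k + 2)) := by
      intro h4
      have h5 : (p : ℤ) ∣ 3 * paramDenom (k + 2) ^ 2 := by
        have : 3 * paramDenom (k + 2) ^ 2 = 4 * quadValue (k + 2) t -
            (2 * t + paramDenom (k + 2)) * (2 * t + paramDenom (k + 2)) := by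
          rw [quadValue_eq]
          ring
        rw [this]
        exact dvd_sub (Dvd.dvd.mul_left hpN _) (Dvd.dvd.mul_left h4 _)
      rcases hpZ.dvd_or_dvd h5 with h5 | h5
      · exact hp3' h5
      · have h6 := hpZ.dvd_of_dvd_pow h5
        rcases paramDenom_eq (k + 2) with h7 | h7 <;> rw [h7] at h6
        · exact hp3' h6
        · exact hpZ.not_dvd_one h6
    have h5 : IsCoprime ((p : ℤ) ^ 2) ((2 * t + paramDenom (k + 2)) ^ k) :=
      IsCoprime.pow ((hpZ.coprime_iff_not_dvd).2 h4)
    have h6 := h5.dvd_of_dvd_mul_right h3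
    exact hpZ.not_isUnit (hsq _ (by rwa [← sq]))

/-- The polynomials `f n t` and `shiftPoly n t` as sums of two `n`-th powers. -/
theorem exists_pow_add_pow (n : ℕ) (t : ℤ) : ∃ A B u v : ℂ, (u - v) ^ 2 = -3 ∧
    3 * (paramDenom n : ℂ) ^ 2 * (A * B) = quadValue n t ∧
    (fInt n t).map (Int.castRingHom ℂ) = C A * (X + C u) ^ n + C B * (X + C v) ^ n ∧
    (shiftPoly n t).map (Int.castRingHom ℂ) = C A * (X + C (t + paramDenom n * u)) ^ n +
      C B * (X + C (t + paramDenom n * v)) ^ n := by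
  have hc : (paramDenom n : ℂ) ≠ 0 := by exact_mod_cast paramDenom_ne_zero n
  obtain ⟨A, B, u, v, h1, h2, h3, h4, h5, h6⟩ := exists_root_data ((t : ℂ) / paramDenom n)
  refine ⟨A, B, u, v, h3, ?_, ?_, ?_⟩
  · rw [quadValue_eq, mul_right_comm, h6]
    push_cast
    field_simp
  · rw [← sum_choose_mul_eq (s := fun k => (gCoeff ((t : ℚ) / paramDenom n) k : ℂ))]
    · have : Int.castRingHom ℂ = (algebraMap ℚ ℂ).comp (Int.castRingHom ℚ) := RingHom.ext_int _ _
      rw [this, ← Polynomial.map_map, fInt_map, f_eq, fRat, Polynomial.map_sum]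
      refine Finset.sum_congr rfl fun i _ => ?_
      rw [Polynomial.map_mul, Polynomial.map_pow, map_X, map_C]
      simp
    · refine eq_of_linear_recurrence ?_ ?_ fun k => ?_
      · rw [h4]
        simp [gCoeff]
      · rw [h5]
        simp [gCoeff]
      · rw [h1, h2, gCoeff_add_two]
        push_cast
        ring
  -- The numbers `t + cu` and `t + cv` have sum `2t + c` and product `quadValue n t`, which gives
  -- the recurrence; the first moment vanishes because `A u + B v = -t/c`.
  · rw [← sum_choose_mul_eq
      (s := fun k => (shiftSeq (2 * t + paramDenom n) (quadValue n t) k : ℂ)), shiftPoly,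
      Polynomial.map_sum]
    · refine Finset.sum_congr rfl fun i _ => ?_
      rw [Polynomial.map_mul, Polynomial.map_pow, map_X, map_C]
      simp
    · refine eq_of_linear_recurrence ?_ ?_ fun k => ?_
      · rw [h4]
        simp [shiftSeq]
      · have : A * (t + paramDenom n * u) + B * (t + paramDenom n * v) =
            (A + B) * t + paramDenom n * (A * u + B * v) := by ring
        rw [this, h4, h5]
        simp only [shiftSeq, Int.cast_zero]
        field_simp
        ring
      · rw [shiftSeq, quadValue_eq]
        push_cast
        linear_combination (-(paramDenom n : ℂ) *
          shiftSeq (2 * t + paramDenom n) (t ^ 2 + paramDenom n * t + paramDenom n ^ 2) (k + 1) +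
          (t * paramDenom n) *
            shiftSeq (2 * t + paramDenom n) (t ^ 2 + paramDenom n * t + paramDenom n ^ 2) k) * h1 +
          paramDenom n ^ 2 *
            shiftSeq (2 * t + paramDenom n) (t ^ 2 + paramDenom n * t + paramDenom n ^ 2) k * h2

theorem shiftPoly_comp (n : ℕ) (t : ℤ) :
    (shiftPoly n t).comp (C (paramDenom n) * X - C t) = C (paramDenom n ^ n) * fInt n t := by
  obtain ⟨A, B, u, v, -, -, hf, hs⟩ := exists_pow_add_pow n t
  refine Polynomial.map_injective (Int.castRingHom ℂ) Int.cast_injective ?_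
  rw [Polynomial.map_comp, hs, Polynomial.map_mul, hf]
  simp only [add_comp, mul_comp, C_comp, pow_comp, X_comp, Polynomial.map_sub, Polynomial.map_mul,
    map_C, map_X]
  simp only [eq_intCast, Int.cast_pow, C_add, C_mul, C_pow]
  have h : ∀ w : ℂ, (C (paramDenom n : ℂ) * X - C (t : ℂ) + (C (t : ℂ) + C (paramDenom n : ℂ) * C w))
      = C (paramDenom n : ℂ) * (X + C w) := fun w => by ring
  rw [h, h, mul_pow, mul_pow]
  ring

/-- The factor `3` occurs at most once in the square-free `M`, so its contribution to `M^(n-1)` is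
absorbed by the `3^(n-1)` on the left; the rest `M'` of `M` is coprime to `I` and can be cancelled.
-/
theorem sq_dvd_of_discr_eq {I D M n k c : ℕ} (hM : Squarefree M)
    (hI : ∀ p : ℕ, p.Prime → p ≠ 3 → p ∣ M → ¬ p ∣ I)
    (h : I ^ 2 * D * (3 * c) ^ (n - 1) = n ^ n * M ^ (n - 1) * 3 ^ k) (hk : k ≤ n ^ 2 / 2) :
    I ^ 2 ∣ n ^ n * 3 ^ (n ^ 2 / 2) := by
  obtain ⟨M', hM', hcop⟩ : ∃ M', M ∣ 3 * M' ∧ Nat.Coprime I M' := by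
    by_cases h3 : 3 ∣ M
    · obtain ⟨M', rfl⟩ := h3
      refine ⟨M', dvd_rfl, Nat.coprime_of_dvd fun p hp hpI hpM => ?_⟩
      by_cases hp3 : p = 3
      · subst hp3
        exact hp.not_isUnit (hM 3 (mul_dvd_mul_left 3 hpM))
      · exact hI p hp hp3 (Dvd.dvd.mul_left hpM 3) hpI
    · refine ⟨M, Dvd.intro_left 3 rfl, Nat.coprime_of_dvd fun p hp hpI hpM => ?_⟩
      by_cases hp3 : p = 3
      · subst hp3
        exact h3 hpM
      · exact hI p hp hp3 hpM hpI
  have h1 : I ^ 2 * 3 ^ (n - 1) ∣ (n ^ n * 3 ^ k * M' ^ (n - 1)) * 3 ^ (n - 1) :=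
    calc I ^ 2 * 3 ^ (n - 1) ∣ I ^ 2 * D * (3 * c) ^ (n - 1) :=
          Dvd.intro (D * c ^ (n - 1)) (by rw [mul_pow]; ring)
      _ = n ^ n * M ^ (n - 1) * 3 ^ k := h
      _ ∣ n ^ n * (3 * M') ^ (n - 1) * 3 ^ k :=
          mul_dvd_mul_right (mul_dvd_mul_left _ (pow_dvd_pow_of_dvd hM' _)) _
      _ = _ := by rw [mul_pow]; ring
  have h2 := Nat.dvd_of_mul_dvd_mul_right (by positivity) h1
  have h3 := (Nat.Coprime.pow 2 (n - 1) hcop).dvd_of_dvd_mul_right h2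
  exact h3.trans (mul_dvd_mul_left _ (pow_dvd_pow _ hk))

/-! ### The index bound for `f n t` -/

section NumberField

variable {K : Type*} [Field K] [NumberField K]

theorem aeval_fInt_eq_zero {n : ℕ} {t : ℤ} {pb : PowerBasis ℚ K}
    (hmin : minpoly ℚ pb.gen = f n t) : aeval pb.gen (fInt n t) = 0 := by
  have h := minpoly.aeval ℚ pb.gen
  rwa [hmin, ← fInt_map, ← algebraMap_int_eq, aeval_map_algebraMap] at h

theorem dim_eq {n : ℕ} {t : ℤ} {pb : PowerBasis ℚ K} (hmin : minpoly ℚ pb.gen = f n t) :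
    pb.dim = n := by
  rw [← pb.natDegree_minpoly, hmin, ← fInt_map, (fInt_monic n t).1.natDegree_map,
    (fInt_monic n t).2]

/-- `cβ - t` still generates the field, so its minimal polynomial has degree `n`, as does the monic
multiple `shiftPoly n t`. -/
theorem minpoly_sub_eq_shiftPoly {n : ℕ} {t : ℤ} {pb : PowerBasis ℚ K}
    (hmin : minpoly ℚ pb.gen = f n t) (hint : IsIntegral ℤ pb.gen) :
    minpoly ℤ ((paramDenom n : K) * pb.gen - t) = shiftPoly n t := by
  set y : K := (paramDenom n : K) * pb.gen - t with hy
  have hyint : IsIntegral ℤ y :=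
    (((isIntegral_algebraMap (R := ℤ) (A := K) (x := paramDenom n))).mul hint).sub
      (isIntegral_algebraMap (R := ℤ) (A := K) (x := t))
  have h0 : aeval y (shiftPoly n t) = 0 := by
    have h1 := congrArg (aeval pb.gen) (shiftPoly_comp n t)
    rw [map_mul, aeval_fInt_eq_zero hmin, mul_zero, aeval_comp] at h1
    rw [← h1]
    congr 1
    simp [hy]
  have hdvd := minpoly.isIntegrallyClosed_dvd hyint h0
  obtain ⟨B, hB⟩ := exists_powerBasis_gen_eq pb (paramDenom_ne_zero n) t
  have hdeg : (minpoly ℤ y).natDegree = n := by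
    rw [← dim_eq hmin, ← pb.finrank, B.finrank, ← B.natDegree_minpoly, hB,
      minpoly.isIntegrallyClosed_eq_field_fractions' ℚ hyint, (minpoly.monic hyint).natDegree_map]
  exact (eq_of_monic_of_dvd_of_natDegree_le (minpoly.monic hyint) (shiftPoly_monic n t).1 hdvd
    (by rw [hdeg, (shiftPoly_monic n t).2])).symm

theorem discr_mul_eq {n : ℕ} (hn : n ≠ 0) {t : ℤ} (hq : quadValue n t ≠ 0) {pb : PowerBasis ℚ K}
    (hmin : minpoly ℚ pb.gen = f n t) :
    ∃ e : ℕ, Algebra.discr ℚ pb.basis * (3 * (paramDenom n : ℚ) ^ 2) ^ (n - 1) =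
      (-1) ^ e * (n ^ n * (quadValue n t : ℚ) ^ (n - 1) * 3 ^ (n * (n - 1) / 2)) := by
  obtain ⟨A, B, u, v, huv, hAB, hf, -⟩ := exists_pow_add_pow n t
  have hB : B ≠ 0 := by
    rintro rfl
    rw [mul_zero, mul_zero] at hAB
    exact hq (by exact_mod_cast hAB.symm)
  have huv' : u ≠ v := by
    rintro rfl
    norm_num at huv
  have hF : (minpoly ℚ pb.gen).map (algebraMap ℚ ℂ) =
      C A * (X + C u) ^ n + C B * (X + C v) ^ n := by
    rw [hmin, ← fInt_map, Polynomial.map_map, ← hf]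
    congr 1
  obtain ⟨e, he⟩ := norm_aeval_derivative pb hn hB huv' (dim_eq hmin) hF
  have heven : n * (n - 1) = 2 * (n * (n - 1) / 2) :=
    (Nat.mul_div_cancel' (Nat.even_mul_pred_self n).two_dvd).symm
  rw [heven, pow_mul, huv, neg_pow (3 : ℂ)] at he
  rw [Algebra.discr_powerBasis_eq_norm, pb.finrank, dim_eq hmin]
  refine ⟨n * (n - 1) / 2 + (e + n * (n - 1) / 2), (algebraMap ℚ ℂ).injective ?_⟩
  simp only [map_mul, he, map_pow, map_neg, map_one, map_natCast, map_intCast, map_ofNat]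
  rw [← hAB]
  ring

/-- A multiple of the ring of integers which is contained in `ℤ[β]`. -/
theorem exists_index_sq_dvd {n : ℕ} (hn : 2 ≤ n) {t : ℤ} (hsq : Squarefree (quadValue n t))
    {pb : PowerBasis ℚ K} (hmin : minpoly ℚ pb.gen = f n t) :
    ∃ I : ℕ, I ^ 2 ∣ n ^ n * 3 ^ (n ^ 2 / 2) ∧
      ∀ z : K, IsIntegral ℤ z → I • z ∈ Algebra.adjoin ℤ {pb.gen} := by
  have hint : IsIntegral ℤ pb.gen := ⟨fInt n t, (fInt_monic n t).1, aeval_fInt_eq_zero hmin⟩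
  obtain ⟨I, hI, ⟨D, hD⟩, hIp⟩ := exists_index pb hint
  refine ⟨I, ?_, hI⟩
  obtain ⟨e, he⟩ := discr_mul_eq (by omega) hsq.ne_zero hmin
  have he' : (I : ℤ) ^ 2 * D * (3 * paramDenom n ^ 2) ^ (n - 1) =
      (-1) ^ e * ((n : ℤ) ^ n * quadValue n t ^ (n - 1) * 3 ^ (n * (n - 1) / 2)) := by
    rw [hD] at he
    exact_mod_cast he
  have he2 := congrArg Int.natAbs he'
  simp only [Int.natAbs_mul, Int.natAbs_pow, Int.natAbs_neg, Int.natAbs_one, one_pow, one_mul,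
    Int.natAbs_natCast] at he2
  -- The last argument compares the exponents of `3`: `n(n-1)/2 ≤ ⌊n²/2⌋`.
  refine sq_dvd_of_discr_eq (Int.squarefree_natAbs.2 hsq) (fun p hp hp3 hpM hpI => ?_) he2
    (Nat.div_le_div_right (by rw [sq]; exact Nat.mul_le_mul_left _ (Nat.sub_le _ _)))
  obtain ⟨z, hz, hpz, hzn⟩ := hIp p hp hpI
  have hpc : ¬ (p : ℤ) ∣ paramDenom n := by
    intro h
    rcases paramDenom_eq n with h7 | h7 <;> rw [h7] at h
    · exact hp3 ((Nat.prime_dvd_prime_iff_eq hp Nat.prime_three).1 (by exact_mod_cast h))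
    · exact (Nat.prime_iff_prime_int.1 hp).not_dvd_one h
  refine hzn (mem_adjoin_of_prime_nsmul_mem (t := t) pb hint hp hpc ?_ hz hpz)
  rw [minpoly_sub_eq_shiftPoly hmin hint]
  exact shiftPoly_isEisensteinAt hn hsq hp hp3 (Int.natCast_dvd.2 hpM)
end NumberField

/-! ### Integrality at roots in `ℂ` and the main theorem -/

open scoped IntermediateField

theorem minpoly_eq_f {n : ℕ} {t : ℤ} (hirr : Irreducible (f n t)) {β : ℂ}
    (hβ : aeval β (f n t) = 0) : minpoly ℚ β = f n t :=
  (minpoly.eq_of_irreducible_of_monic hirr hβ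
    (by rw [← fInt_map]; exact (fInt_monic n t).1.map _)).symm

theorem degree_f (n : ℕ) (t : ℤ) : (f n t).degree = n := by
  have h := (fInt_monic n t).1.map (Int.castRingHom ℚ)
  rw [fInt_map] at h
  rw [degree_eq_natDegree h.ne_zero, ← fInt_map, (fInt_monic n t).1.natDegree_map,
    (fInt_monic n t).2]

theorem exists_powerBasis_adjoin {n : ℕ} {t : ℤ} (hirr : Irreducible (f n t)) {β : ℂ}
    (hβ : aeval β (f n t) = 0) : NumberField ℚ⟮β⟯ ∧
      ∃ pb : PowerBasis ℚ ℚ⟮β⟯, (pb.gen : ℂ) = β ∧ minpoly ℚ pb.gen = f n t := by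
  have hint : IsIntegral ℚ β := by
    refine ⟨f n t, ?_, hβ⟩
    rw [← fInt_map]
    exact (fInt_monic n t).1.map _
  have := IntermediateField.adjoin.finiteDimensional hint
  refine ⟨{}, IntermediateField.adjoin.powerBasis hint, ?_, ?_⟩
  · rw [IntermediateField.adjoin.powerBasis_gen, IntermediateField.AdjoinSimple.coe_gen]
  · rw [IntermediateField.adjoin.powerBasis_gen]
    exact (IntermediateField.minpoly_gen ℚ β).trans (minpoly_eq_f hirr hβ)

theorem coe_aeval_mem {K : IntermediateField ℚ ℂ} (x : K) (P : ℚ[X]) :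
    ((aeval x P : K) : ℂ) = aeval (x : ℂ) P :=
  (aeval_algebraMap_apply ℂ x P).symm

theorem aeval_map_intCast (β : ℂ) (Q : ℤ[X]) :
    aeval β (Q.map (Int.castRingHom ℚ)) = aeval β Q := by
  rw [← algebraMap_int_eq, aeval_map_algebraMap]

theorem isIntegral_coe_iff {K : IntermediateField ℚ ℂ} (z : K) :
    IsIntegral ℤ (z : ℂ) ↔ IsIntegral ℤ z :=
  isIntegral_algebraMap_iff (A := K) (B := ℂ) (algebraMap K ℂ).injective

/-- Integral elements of `ℚ(β)` have the common denominator `d`. -/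
theorem exists_map_eq_C_mul {n : ℕ} (hn : 2 ≤ n) {t : ℤ} (hsq : Squarefree (quadValue n t))
    (hirr : Irreducible (f n t)) {β : ℂ} (hβ : aeval β (f n t) = 0) {d : ℕ}
    (hd : ∀ I : ℕ, I ^ 2 ∣ n ^ n * 3 ^ (n ^ 2 / 2) → I ∣ d) {P : ℚ[X]} (hP : P.degree < n)
    (hint : IsIntegral ℤ (aeval β P)) :
    ∃ Q : ℤ[X], Q.map (Int.castRingHom ℚ) = C (d : ℚ) * P := by
  obtain ⟨_, pb, hgen, hmin⟩ := exists_powerBasis_adjoin hirr hβ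
  obtain ⟨I, hI, hIz⟩ := exists_index_sq_dvd hn hsq hmin
  obtain ⟨k, hk⟩ := hd I hI
  have hz : IsIntegral ℤ (aeval pb.gen P) := by
    rw [← isIntegral_coe_iff, coe_aeval_mem, hgen]
    exact hint
  have hdz : d • aeval pb.gen P ∈ Algebra.adjoin ℤ {pb.gen} := by
    rw [hk, mul_comm, mul_smul]
    exact nsmul_mem (hIz _ hz) k
  rw [Algebra.adjoin_singleton_eq_range_aeval] at hdz
  obtain ⟨Q, hQ⟩ := hdz
  have hm := (fInt_monic n t).1
  -- Reduction modulo the monic `fInt n t` keeps the coefficients integral and brings the degree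
  -- below `n`, where a polynomial is determined by its value at `β`.
  refine ⟨Q %ₘ fInt n t, ?_⟩
  have hmod : (Q %ₘ fInt n t).map (Int.castRingHom ℚ) = Q.map (Int.castRingHom ℚ) %ₘ f n t := by
    rw [map_modByMonic _ hm, fInt_map]
  have hfm : (f n t).Monic := by
    rw [← fInt_map]
    exact hm.map _
  rw [hmod, ← sub_eq_zero]
  refine eq_zero_of_dvd_of_degree_lt (p := f n t) ?_ ?_
  · rw [← hmin]
    refine minpoly.dvd ℚ _ ?_
    rw [map_sub, aeval_modByMonic_eq_self_of_root (minpoly.aeval ℚ pb.gen), map_mul,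
      aeval_C, map_natCast, ← nsmul_eq_mul, ← hQ, ← algebraMap_int_eq, aeval_map_algebraMap]
    exact sub_self _
  · refine (degree_sub_le _ _).trans_lt (max_lt (degree_modByMonic_lt _ hfm) ?_)
    rw [degree_f, ← smul_eq_C_mul]
    exact (degree_smul_le _ _).trans_lt hP

/-- Clearing the common denominator `d` reduces this to the transfer modulo `d^n`, a divisor of
`n₀`. -/
theorem isIntegral_aeval_of_intCast_eq {n n₀ : ℕ} (hn : 2 ≤ n) {t t' : ℤ}
    (hsq : Squarefree (quadValue n t)) (hirr : Irreducible (f n t)) {β β' : ℂ}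
    (hβ : aeval β (f n t) = 0) (hβ' : aeval β' (f n t') = 0) {d : ℕ} (hd0 : d ≠ 0)
    (hdn : d ^ n ∣ n₀) (hd : ∀ I : ℕ, I ^ 2 ∣ n ^ n * 3 ^ (n ^ 2 / 2) → I ∣ d)
    (htt' : (t : ZMod n₀) = t') {P : ℚ[X]} (hP : P.degree < n)
    (hint : IsIntegral ℤ (aeval β P)) : IsIntegral ℤ (aeval β' P) := by
  obtain ⟨Q, hQ⟩ := exists_map_eq_C_mul hn hsq hirr hβ hd hP hint
  have hdc : (d : ℂ) ≠ 0 := by exact_mod_cast hd0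
  have hval : ∀ x : ℂ, aeval x P = aeval x Q / (d : ℂ) := by
    intro x
    rw [← aeval_map_intCast, hQ, map_mul, aeval_C, map_natCast, mul_div_cancel_left₀ _ hdc]
  rw [hval] at hint ⊢
  have hdeg := (fInt_monic n t).2
  refine isIntegral_aeval_div_of_map_eq (fInt_monic n t).1 (fInt_monic n t').1
    ((fInt_monic n t').2.trans hdeg.symm) (by rwa [fInt_map]) Q hd0 ?_ ?_ ?_ hint
  · rw [hdeg]
    refine fInt_map_zmod_eq ?_
    have := congrArg (ZMod.castHom hdn (ZMod (d ^ n))) htt'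
    simpa using this
  · rwa [← aeval_map_intCast, fInt_map]
  · rwa [← aeval_map_intCast, fInt_map]

end SimplestFields

open SimplestFields Polynomial in
theorem mainTheorem1 (n : ℕ) (hn : 2 ≤ n) (n₀ : ℕ) (hn₀ : SimplestFields.IsPeriodBound n n₀) :
    SimplestFields.RepeatsPeriodically n (SimplestFields.f n)
      {t : ℤ | Squarefree (SimplestFields.quadValue n t)} n₀ := by
  obtain ⟨d, hd0, hdn, hd⟩ := hn₀.exists_denominator (by omega)
  intro r
  by_cases hex : ∃ t₀ : ℤ, Squarefree (quadValue n t₀) ∧ (t₀ : ZMod n₀) = r ∧ Irreducible (f n t₀)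
  swap
  -- A residue class without admissible parameters imposes no condition beyond the degrees.
  · refine ⟨fun i => X ^ (i : ℕ), fun i => degree_X_pow _, fun t ht htr hirr => ?_⟩
    exact (hex ⟨t, ht, htr, hirr⟩).elim
  obtain ⟨t₀, hsq₀, ht₀, hirr₀⟩ := hex
  obtain ⟨β₀, hβ₀⟩ := IsAlgClosed.exists_aeval_eq_zero ℂ (f n t₀) hirr₀.degree_pos.ne'
  have hint₀ : IsIntegral ℤ β₀ :=
    ⟨fInt n t₀, (fInt_monic n t₀).1, by rwa [← fInt_map, aeval_map_intCast] at hβ₀⟩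
  -- The lattice is built from one sample parameter `t₀` of the class.
  let L : AddSubgroup ℚ[X] :=
    { carrier := {P | P.degree < n ∧ IsIntegral ℤ (aeval β₀ P)}
      zero_mem' := ⟨by rw [degree_zero]; exact WithBot.bot_lt_coe n, by
        rw [map_zero]; exact isIntegral_zero⟩
      add_mem' := fun {P Q} hP hQ => ⟨(degree_add_le _ _).trans_lt (max_lt hP.1 hQ.1), by
        rw [map_add]; exact hP.2.add hQ.2⟩
      neg_mem' := fun {P} hP => ⟨by rw [degree_neg]; exact hP.1, by
        rw [map_neg]; exact hP.2.neg⟩ }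
  obtain ⟨h, hdeg, hL, hspan⟩ := exists_triangular_generators L hd0
    (fun i hi => ⟨by rw [degree_X_pow]; exact_mod_cast hi, by
      rw [map_pow, aeval_X]; exact hint₀.pow i⟩)
    (fun P hP => ⟨hP.1, exists_map_eq_C_mul hn hsq₀ hirr₀ hβ₀ hd hP.1 hP.2⟩)
  refine ⟨h, hdeg, fun t ht htr hirr β hβ => ?_⟩
  obtain ⟨_, pb, hgen, hmin⟩ := exists_powerBasis_adjoin hirr hβ
  refine isIntegralBasis_of_span (pb.finrank.trans (dim_eq hmin)) (fun i => ?_) (fun i => ?_)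
    fun z hzK hz => ?_
  · have h1 := (aeval pb.gen (h i)).2
    rwa [coe_aeval_mem, hgen] at h1
  · exact isIntegral_aeval_of_intCast_eq hn hsq₀ hirr₀ hβ₀ hβ hd0 hdn hd (ht₀.trans htr.symm)
      (hL i).1 (hL i).2
  · obtain ⟨P, hPdeg, hP⟩ := pb.exists_eq_aeval ⟨z, hzK⟩
    have hzP : z = aeval β P := by
      rw [← hgen, ← coe_aeval_mem, ← hP]
    have hPdeg' : P.degree < n := by
      rw [dim_eq hmin] at hPdeg
      exact degree_le_natDegree.trans_lt (by exact_mod_cast hPdeg)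
    -- Here integrality is transferred back, from `t` to `t₀`; this gives spanning, while the
    -- forward transfer gave integrality of the `h i`.
    have hPL : P ∈ L := ⟨hPdeg', isIntegral_aeval_of_intCast_eq hn ht hirr hβ hβ₀ hd0 hdn hd
      (htr.trans ht₀.symm) hPdeg' (hzP ▸ hz)⟩
    have h1 := Submodule.mem_map_of_mem (f := ((aeval β : ℚ[X] →ₐ[ℚ] ℂ).toLinearMap).restrictScalars ℤ)
      (hspan P hPL)
    rw [Submodule.map_span, ← Set.range_comp] at h1
    rw [hzP]
    exact h1
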